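/- Say that a finite group $G$ of order $n$ is an ACLT group if for every divisor $d$ of $n$ with $d<n$ there is an abelian subgroup of $G$ of order $d$. Say that a group $G$ is supersolvable if it has a finite series of subgroups $\{e\}=N_0\le N_1\le\cdots\le N_m=G$ such that every $N_i$ is normal in $G$ and every factor $N_{i+1}/N_i$ $(0\le i<m)$ is cyclic. Theorem. Every ACLT group is supersolvable. -/

import Mathlib

/-- A finite group `G` is an ACLT (abelian CLT) group if, for every divisor `d` of its order `n`
with `d < n`, it has an abelian subgroup of order `d`. -/
def IsACLT (G : Type*) [Group G] [Finite G] : Prop :=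
  ∀ d : ℕ, d ∣ Nat.card G → d < Nat.card G →
    ∃ H : Subgroup G, IsMulCommutative H ∧ Nat.card H = d

/-- A group `G` is supersolvable if it has a finite series
`1 = N 0 ≤ N 1 ≤ ⋯ ≤ N m = G` of subgroups, all of them normal in the whole of `G`, with cyclic
factors `N (i + 1) / N i` for `i < m`. (The values of `N` beyond `m` play no role: any series of
length `m` may be continued by `G`.) -/
def IsSupersolvable (G : Type*) [Group G] : Prop :=
  ∃ (m : ℕ) (N : ℕ → Subgroup G) (_ : ∀ i, (N i).Normal),
    N 0 = ⊥ ∧ N m = ⊤ ∧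
      ∀ i < m, N i ≤ N (i + 1) ∧ IsCyclic (N (i + 1) ⧸ (N i).subgroupOf (N (i + 1)))

/-! If the order is a prime power, central elements of successive quotients build the series.
Otherwise let `p` be the least prime divisor and `q` another; take abelian `A`, `B` of index `p`,
`q`. Then `A` is normal, and coprime indices force `A ⊔ B = ⊤`, so `A ⊓ B` is central. In `1 ≤ A ⊓ B
≤ A ≤ G` the top factors have orders `q` and `p`, and the bottom one refines since every subgroup of
the centre is normal. -/

/-- `N` and `M` are normal subgroups, `N ≤ M`, and the factor `M / N` is cyclic. -/
def IsCyclicStep {G : Type*} [Group G] (N M : Subgroup G) : Prop :=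
  ∃ _ : N.Normal, M.Normal ∧ N ≤ M ∧ IsCyclic (M ⧸ N.subgroupOf M)

open Relation Subgroup

theorem exists_series_of_reflTransGen {G : Type*} [Group G] {M : Subgroup G}
    (h : ReflTransGen IsCyclicStep ⊥ M) :
    ∃ (m : ℕ) (N : ℕ → Subgroup G) (_ : ∀ i, (N i).Normal),
      N 0 = ⊥ ∧ N m = M ∧
        ∀ i < m, N i ≤ N (i + 1) ∧ IsCyclic (N (i + 1) ⧸ (N i).subgroupOf (N (i + 1))) := by
  induction h with
  | refl => exact ⟨0, fun _ => ⊥, fun _ => inferInstance, rfl, rfl, by simp⟩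
  | @tail L M _ hstep ih =>
    obtain ⟨m, N, hN, h0, hm, hs⟩ := ih
    obtain ⟨hL, hM, hle, hcyc⟩ := hstep
    -- The quotient type depends on both subgroups, so rewriting the `if`s in place is awkward; this
    -- transports along equalities.
    have key : ∀ (A B A' B' : Subgroup G) (_ : A.Normal) (_ : A'.Normal), A = A' → B = B' →
        (A ≤ B ∧ IsCyclic (B ⧸ A.subgroupOf B)) → A' ≤ B' ∧ IsCyclic (B' ⧸ A'.subgroupOf B') := by
      rintro A B _ _ _ _ rfl rfl h
      exact h
    have hN' : ∀ i, (if i ≤ m then N i else M).Normal := by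
      intro i
      split_ifs
      exacts [hN i, hM]
    refine ⟨m + 1, fun i => if i ≤ m then N i else M, hN', by simpa using h0, by simp, ?_⟩
    intro i hi
    rcases Nat.lt_succ_iff_lt_or_eq.mp hi with hi | rfl
    · exact key _ _ _ _ (hN i) (hN' i) (if_pos hi.le).symm (if_pos (Nat.succ_le_of_lt hi)).symm
        (hs i hi)
    · exact key _ _ _ _ hL (hN' i) (by simp [hm]) (by simp) ⟨hle, hcyc⟩

theorem isSupersolvable_of_reflTransGen {G : Type*} [Group G]
    (h : ReflTransGen IsCyclicStep (⊥ : Subgroup G) ⊤) : IsSupersolvable G :=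
  exists_series_of_reflTransGen h

theorem normal_of_le_center_subgroup {G : Type*} [Group G] {H : Subgroup G} (hH : H ≤ center G) :
    H.Normal where
  conj_mem n hn g := by rwa [mem_center_iff.mp (hH hn) g, mul_inv_cancel_right]

theorem isCyclicStep_comap_zpowers {G : Type*} [Group G] (N : Subgroup G) [N.Normal] (x : G)
    (hx : (x : G ⧸ N) ∈ center (G ⧸ N)) :
    IsCyclicStep N ((zpowers (x : G ⧸ N)).comap (QuotientGroup.mk' N)) := by
  have hnormal : (zpowers (x : G ⧸ N)).Normal :=
    normal_of_le_center_subgroup (by simpa [zpowers_le] using hx)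
  refine ⟨inferInstance, inferInstance, ?_, ?_⟩
  · intro n hn
    have : (n : G ⧸ N) = 1 := (QuotientGroup.eq_one_iff n).mpr hn
    simp [this, one_mem]
  · refine ⟨QuotientGroup.mk ⟨x, by simp⟩, fun y => ?_⟩
    obtain ⟨⟨y, hy⟩, rfl⟩ := QuotientGroup.mk_surjective y
    obtain ⟨k, hk⟩ := mem_zpowers_iff.mp (mem_comap.mp hy)
    refine ⟨k, ?_⟩
    change QuotientGroup.mk (_ ^ k) = _
    rw [QuotientGroup.eq, mem_subgroupOf]
    have hk' : ((x ^ k : G) : G ⧸ N) = y := hk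
    simpa using QuotientGroup.eq.mp hk'

/-- Adjoining `x` to `L` gives a strictly larger normal subgroup still inside `K`; finiteness ends
the climb. Serves both central subgroups and `p`-groups. -/
theorem reflTransGen_isCyclicStep_of_exists_mem_center {G : Type*} [Group G] [Finite G]
    (K : Subgroup G) (h : ∀ L : Subgroup G, ∀ _ : L.Normal, L < K →
      ∃ x ∈ K, x ∉ L ∧ (x : G ⧸ L) ∈ center (G ⧸ L))
    (L : Subgroup G) (hL : L.Normal) (hLK : L ≤ K) : ReflTransGen IsCyclicStep L K := by
  revert hL hLK
  induction L using WellFoundedGT.induction with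
  | _ L ih =>
    intro hL hLK
    rcases hLK.eq_or_lt with rfl | hlt
    · exact .refl
    · obtain ⟨x, hxK, hxL, hx⟩ := h L hL hlt
      have hstep := isCyclicStep_comap_zpowers L x hx
      obtain ⟨_, hM, hle, -⟩ := id hstep
      refine .head hstep (ih _ (lt_of_le_of_ne hle ?_) hM ?_)
      · intro heq
        apply hxL
        rw [heq]
        simp
      · intro y hy
        obtain ⟨k, hk⟩ := mem_zpowers_iff.mp (mem_comap.mp hy)
        have hk' : ((x ^ k : G) : G ⧸ L) = y := hk
        have := mul_mem (zpow_mem hxK k) (hLK (QuotientGroup.eq.mp hk'))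
        simpa using this

theorem reflTransGen_isCyclicStep_of_le_center {G : Type*} [Group G] [Finite G]
    {K : Subgroup G} (hK : K ≤ center G) : ReflTransGen IsCyclicStep ⊥ K := by
  refine reflTransGen_isCyclicStep_of_exists_mem_center K (fun L _ hlt => ?_) ⊥ inferInstance bot_le
  obtain ⟨x, hxK, hxL⟩ := SetLike.exists_of_lt hlt
  refine ⟨x, hxK, hxL, mem_center_iff.mpr fun y => ?_⟩
  obtain ⟨y, rfl⟩ := QuotientGroup.mk_surjective y
  exact congrArg QuotientGroup.mk (mem_center_iff.mp (hK hxK) y)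

theorem IsPGroup.isSupersolvable {G : Type*} [Group G] [Finite G] {p : ℕ} [Fact p.Prime]
    (hG : IsPGroup p G) : IsSupersolvable G := by
  refine isSupersolvable_of_reflTransGen
    (reflTransGen_isCyclicStep_of_exists_mem_center ⊤ (fun L _ hlt => ?_) ⊥ inferInstance bot_le)
  have : Nontrivial (G ⧸ L) := QuotientGroup.nontrivial_iff.mpr hlt.ne
  have := (hG.to_quotient L).center_nontrivial
  obtain ⟨⟨x, hx⟩, hx1⟩ := exists_ne (1 : center (G ⧸ L))
  obtain ⟨x, rfl⟩ := QuotientGroup.mk_surjective x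
  refine ⟨x, mem_top x, fun hxL => hx1 ?_, hx⟩
  exact Subtype.ext ((QuotientGroup.eq_one_iff x).mpr hxL)

theorem isCyclicStep_of_relIndex_prime {G : Type*} [Group G] {N M : Subgroup G} (hN : N.Normal)
    (hM : M.Normal) (hle : N ≤ M) {p : ℕ} (hp : p.Prime) (h : N.relIndex M = p) :
    IsCyclicStep N M :=
  have := Fact.mk hp
  ⟨hN, hM, hle, isCyclic_of_prime_card (p := p) h⟩

/-- A group with abelian subgroups of distinct prime indices `p` and `q`, the first one normal,
is supersolvable: the intersection of the two subgroups is central of index `p * q`. -/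
theorem isSupersolvable_of_index_prime {G : Type*} [Group G] [Finite G] {A B : Subgroup G}
    [IsMulCommutative A] [IsMulCommutative B] [hA : A.Normal] {p q : ℕ} (hp : p.Prime)
    (hq : q.Prime) (hpq : p ≠ q) (hAp : A.index = p) (hBq : B.index = q) :
    IsSupersolvable G := by
  have hco : Nat.Coprime A.index B.index := by
    rw [hAp, hBq]
    exact (Nat.coprime_primes hp hq).mpr hpq
  have hsup : A ⊔ B = ⊤ := by
    rw [← index_eq_one]
    exact Nat.eq_one_of_dvd_coprimes hco (index_dvd_of_le le_sup_left)
      (index_dvd_of_le le_sup_right)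
  have hZ : A ⊓ B ≤ center G := by
    intro z hz
    have : (⊤ : Subgroup G) ≤ centralizer {z} := by
      rw [← hsup, sup_le_iff]
      refine ⟨fun a ha => ?_, fun b hb => ?_⟩
      · exact mem_centralizer_singleton_iff.mpr (setLike_mul_comm ha hz.1)
      · exact mem_centralizer_singleton_iff.mpr (setLike_mul_comm hb hz.2)
    exact mem_center_iff.mpr fun g => mem_centralizer_singleton_iff.mp (this (mem_top g))
  have hrel : (A ⊓ B).relIndex A = q := by
    -- Compute the index of `A ⊓ B` through `A` and through `B`, then cancel `p`.
    have h1 : (A ⊓ B).relIndex A * A.index = (A ⊓ B).index := relIndex_mul_index inf_le_left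
    have h2 : (A ⊓ B).relIndex B * B.index = (A ⊓ B).index := relIndex_mul_index inf_le_right
    have h3 : A.relIndex B = p := by
      rw [← relIndex_sup_left, hsup, relIndex_top_right, hAp]
    rw [inf_relIndex_right, h3, hBq, ← h1, hAp, mul_comm] at h2
    exact (Nat.eq_of_mul_eq_mul_right hp.pos h2).symm
  exact isSupersolvable_of_reflTransGen <|
    ((reflTransGen_isCyclicStep_of_le_center hZ).tail
      (isCyclicStep_of_relIndex_prime (normal_of_le_center_subgroup hZ) hA inf_le_left hq hrel)).tail
      (isCyclicStep_of_relIndex_prime hA inferInstance le_top hp (by rw [relIndex_top_right, hAp]))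

theorem IsACLT.exists_index_eq {G : Type*} [Group G] [Finite G] (hG : IsACLT G) {p : ℕ}
    (hp : p.Prime) (hdvd : p ∣ Nat.card G) :
    ∃ H : Subgroup G, IsMulCommutative H ∧ H.index = p := by
  obtain ⟨H, hH, hcard⟩ := hG (Nat.card G / p) (Nat.div_dvd_of_dvd hdvd)
    (Nat.div_lt_self Nat.card_pos hp.one_lt)
  refine ⟨H, hH, ?_⟩
  have h := H.card_mul_index
  rw [hcard] at h
  exact Nat.eq_of_mul_eq_mul_left (Nat.div_pos (Nat.le_of_dvd Nat.card_pos hdvd) hp.pos)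
    (h.trans (Nat.div_mul_cancel hdvd).symm)

theorem mainTheorem3 (G : Type*) [Group G] [Finite G] (hG : IsACLT G) : IsSupersolvable G := by
  rcases subsingleton_or_nontrivial G with _ | _
  -- `Nat.minFac 1 = 1` is not prime, so the trivial group is treated apart, as a 2-group.
  · have := Fact.mk Nat.prime_two
    exact (IsPGroup.of_card (p := 2) (n := 0) (by simp)).isSupersolvable
  have hp : (Nat.card G).minFac.Prime := Nat.minFac_prime Finite.one_lt_card.ne'
  have := Fact.mk hp
  by_cases h : ∃ q, q.Prime ∧ q ∣ Nat.card G ∧ (Nat.card G).minFac ≠ q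
  · obtain ⟨q, hq, hdvd, hne⟩ := h
    obtain ⟨A, _, hAi⟩ := hG.exists_index_eq hp (Nat.minFac_dvd _)
    obtain ⟨B, _, hBi⟩ := hG.exists_index_eq hq hdvd
    have : A.Normal := normal_of_index_eq_minFac_card hAi
    exact isSupersolvable_of_index_prime hp hq hne hAi hBi
  · push Not at h
    refine (IsPGroup.of_card (p := (Nat.card G).minFac)
      (n := (Nat.card G).primeFactorsList.length) ?_).isSupersolvable
    exact Nat.eq_prime_pow_of_unique_prime_dvd Nat.card_pos.ne' fun hq hd => (h _ hq hd).symm
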